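/- A *simple mixed graph* $G=(V_G,E_G,\vec E_G)$ consists of a finite vertex set $V_G$, a set $E_G$ of edges (unordered pairs of distinct vertices) and a set $\vec E_G$ of arcs (ordered pairs of distinct vertices); edges and arcs on the same pair of vertices may coexist. Its undirected part $G_u$ is the graph $(V_G,E_G)$. A *submixed graph* of $G$ is a mixed graph $G'$ with $V_{G'}\subseteq V_G$, $E_{G'}\subseteq E_G$, $\vec E_{G'}\subseteq\vec E_G$; submixed graphs are ordered by inclusion of vertices, edges and arcs. A *walk* may use edges and may traverse arcs forwards (from tail to head) or backwards; it is *alternating* if its successive arcs (ignoring the edges in between) are traversed alternately forwards and backwards (a walk with at most one arc is alternating). A submixed graph $G'$ of $G$ with at least one arc is *special* if 1. any two distinct vertices of $G'$ are joined by an alternating walk in $G'$, and 2. whenever a connected component $H$ of $G'_u$ contains a vertex that is the head of an arc of $G'$ and a vertex that is the tail of an arc of $G'$, then for every vertex $v$ of $H$ there is a closed alternating walk in $G'$ from $v$ to $v$ containing an odd number of arcs (counted with repetition). A *mixed component* of $G$ is a submixed graph $G'$ of $G$ of one of the following types: (Type I) $G'$ is a connected component of $G_u$ all of whose vertices have out-degree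 $0$ in $G$; (Type II) $G'$ is a connected component of $G_u$ all of whose vertices have in-degree $0$ in $G$; (Type III) $G'$ is a maximal special submixed graph of $G$. A submixed graph that is both of Type I and of Type II is counted as two mixed components. $G$ is *uniconnected* if it has exactly one mixed component. For $V_G=\{v_1,\dots,v_n\}$, the *integrated adjacency matrix* of $G$ is the real symmetric $2n\times 2n$ matrix $$\mathcal I(G)=\begin{bmatrix} A & D\\ D^{T} & A\end{bmatrix},$$ where $A_{ij}=1$ if $\{v_i,v_j\}\in E_G$ and $A_{ij}=0$ otherwise, and $D_{ij}=1$ if $(v_i,v_j)\in\vec E_G$ and $D_{ij}=0$ otherwise. Let $\lambda_1(G)$ denote its largest eigenvalue. **Theorem.** A simple mixed graph $G$ is uniconnected if and only if $\lambda_1(G)$ is a simple eigenvalue of $\mathcal I(G)$ (that is, of algebraic multiplicity one) which has an eigenvector all of whose entries are positive. -/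

import Mathlib

/-- A simple mixed graph on the vertex set `V`: a loopless undirected graph without multiple edges,
together with a loopless set of arcs without multiple arcs. Edges and arcs are independent of each
other: an edge `{u, v}` and the arcs `(u, v)`, `(v, u)` may all be present at once. -/
structure SimpleMixedGraph (V : Type*) where
  /-- the undirected part -/
  graph : SimpleGraph V
  /-- `Arc u v` says that there is an arc from `u` to `v` -/
  Arc : V → V → Prop
  arc_irrefl : ∀ v, ¬ Arc v v

namespace SimpleMixedGraph

variable {V : Type*}

open Classical in
/-- The adjacency matrix of the undirected part. -/
noncomputable def edgeMatrix (G : SimpleMixedGraph V) : Matrix V V ℝ :=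
  Matrix.of fun u v => if G.graph.Adj u v then 1 else 0

open Classical in
/-- The adjacency matrix of the directed part. -/
noncomputable def arcMatrix (G : SimpleMixedGraph V) : Matrix V V ℝ :=
  Matrix.of fun u v => if G.Arc u v then 1 else 0

/-- The integrated adjacency matrix: `Sum.inl v` and `Sum.inr v` are the two copies `v'` and `v''`
of the vertex `v`. -/
noncomputable def integratedAdjMatrix (G : SimpleMixedGraph V) : Matrix (V ⊕ V) (V ⊕ V) ℝ :=
  Matrix.fromBlocks G.edgeMatrix G.arcMatrix G.arcMatrix.transpose G.edgeMatrix

/-- A submixed graph: a subgraph of the undirected part (a set of vertices and a set of edges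
between them) together with a set of arcs between the chosen vertices. -/
structure Submixed (G : SimpleMixedGraph V) extends SimpleGraph.Subgraph G.graph where
  /-- the arcs of the submixed graph -/
  Arc : V → V → Prop
  arc_sub : ∀ {u v : V}, Arc u v → G.Arc u v
  arc_fst_mem : ∀ {u v : V}, Arc u v → u ∈ verts
  arc_snd_mem : ∀ {u v : V}, Arc u v → v ∈ verts

namespace Submixed

variable {G : SimpleMixedGraph V}

/-- `H ≤ K` when the vertices, edges and arcs of `H` are among those of `K`. -/
instance : LE (Submixed G) where
  le H K := H.toSubgraph ≤ K.toSubgraph ∧ ∀ u v, H.Arc u v → K.Arc u v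

/-- Walks in a submixed graph. An arc may be traversed forwards (from its tail to its head) or
backwards. -/
inductive Walk (H : Submixed G) : V → V → Type _
  | nil {v : V} (hv : v ∈ H.verts) : Walk H v v
  | edge {u v w : V} (h : H.Adj u v) (p : Walk H v w) : Walk H u w
  | forward {u v w : V} (h : H.Arc u v) (p : Walk H v w) : Walk H u w
  | backward {u v w : V} (h : H.Arc v u) (p : Walk H v w) : Walk H u w

namespace Walk

/-- The directions in which a walk traverses its successive arcs (`true` for forward, `false` for
backward), the edges being skipped. -/
def arcDirections {H : Submixed G} : {u v : V} → H.Walk u v → List Bool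
  | _, _, nil _ => []
  | _, _, edge _ p => p.arcDirections
  | _, _, forward _ p => true :: p.arcDirections
  | _, _, backward _ p => false :: p.arcDirections

/-- The number of arcs in a walk, counted with repetition. -/
def numArcs {H : Submixed G} {u v : V} (p : H.Walk u v) : ℕ :=
  p.arcDirections.length

/-- A walk is alternating if its successive arcs alternate between the two directions. -/
def IsAlternating {H : Submixed G} {u v : V} (p : H.Walk u v) : Prop :=
  p.arcDirections.IsChain (· ≠ ·)

end Walk

/-- The undirected part of a submixed graph, as a simple graph on its vertices. -/
def undirectedPart (H : Submixed G) : SimpleGraph H.verts :=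
  H.toSubgraph.coe

/-- Special submixed graphs. -/
structure IsSpecial (H : Submixed G) : Prop where
  exists_arc : ∃ u v, H.Arc u v
  joined : ∀ u ∈ H.verts, ∀ v ∈ H.verts, u ≠ v → ∃ p : H.Walk u v, p.IsAlternating
  odd_closed : ∀ C : H.undirectedPart.ConnectedComponent,
    (∃ x ∈ C.supp, ∃ w, H.Arc w x) → (∃ y ∈ C.supp, ∃ w, H.Arc y w) →
      ∀ v ∈ C.supp, ∃ p : H.Walk v v, p.IsAlternating ∧ Odd p.numArcs

/-- `H` is a connected component of the undirected part of `G`. -/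
def IsUndirectedComponent (H : Submixed G) : Prop :=
  (∃ C : G.graph.ConnectedComponent, H.toSubgraph = C.toSubgraph) ∧ ∀ u v, ¬ H.Arc u v

end Submixed

/-- The three types of mixed components. -/
inductive ComponentType
  | I
  | II
  | III

/-- `G.IsMixedComponent t H` says that `H` is a mixed component of `G` of type `t`. -/
def IsMixedComponent (G : SimpleMixedGraph V) : ComponentType → Submixed G → Prop
  | .I, H => H.IsUndirectedComponent ∧ ∀ u ∈ H.verts, ∀ w, ¬ G.Arc u w
  | .II, H => H.IsUndirectedComponent ∧ ∀ u ∈ H.verts, ∀ w, ¬ G.Arc w u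
  | .III, H => Maximal Submixed.IsSpecial H

/-- The mixed components of `G`, each together with its type: a submixed graph that is a mixed
component both of Type I and of Type II is counted twice. -/
def mixedComponents (G : SimpleMixedGraph V) : Set (ComponentType × Submixed G) :=
  {c | G.IsMixedComponent c.1 c.2}

/-- `G` is uniconnected if it has exactly one mixed component. -/
def Uniconnected (G : SimpleMixedGraph V) : Prop :=
  G.mixedComponents.encard = 1

/-- `μ` is the largest eigenvalue of the integrated adjacency matrix of `G`. -/
def IsLargestEigenvalue [Fintype V] [DecidableEq V] (G : SimpleMixedGraph V) (μ : ℝ) : Prop :=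
  IsGreatest {x : ℝ | Module.End.HasEigenvalue (Matrix.toLin' G.integratedAdjMatrix) x} μ

end SimpleMixedGraph

/-! `integratedAdjMatrix` is the adjacency matrix of an ordinary graph `double` on two copies of the
vertices: an edge joins equal copies of its ends, an arc joins the first copy of its tail to the
second copy of its head. A path there is an alternating walk in `G`, the copy recording the
direction required of the next arc, so each arc switches copies.

Hence mixed components correspond to connected components of `double` (`componentOf_mem`,
`exists_componentOf`, `componentOf_eq_iff`): a component using some arc projects to a maximal
special submixed graph, and an arc-free one is a single copy of an undirected component, of Type I
for the first copy and Type II for the second. Uniconnectedness is thus connectedness of `double`,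
which Perron–Frobenius theory detects (`connected_iff_adjMatrix_eigenvector`). -/

namespace Matrix

/-! ### Eigenvalues of real symmetric matrices -/

variable {n : Type*} [Fintype n] [DecidableEq n]

theorem hasEigenvector_toLin'_iff {A : Matrix n n ℝ} {μ : ℝ} {x : n → ℝ} :
    Module.End.HasEigenvector (toLin' A) μ x ↔ A *ᵥ x = μ • x ∧ x ≠ 0 := by
  rw [Module.End.hasEigenvector_iff, Module.End.mem_eigenspace_iff, toLin'_apply]

/-- An upper bound of the eigenvalues of a symmetric real matrix gives a positive semidefinite
shift. -/
theorem IsHermitian.posSemidef_smul_one_sub {A : Matrix n n ℝ} (hA : A.IsHermitian) {μ : ℝ}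
    (hμ : ∀ ν, Module.End.HasEigenvalue (toLin' A) ν → ν ≤ μ) :
    (μ • (1 : Matrix n n ℝ) - A).PosSemidef := by
  have hM : (μ • (1 : Matrix n n ℝ) - A).IsHermitian := by
    refine IsHermitian.sub ?_ hA
    simp [IsHermitian]
  rw [hM.posSemidef_iff_eigenvalues_nonneg]
  intro i
  have h := hM.mulVec_eigenvectorBasis i
  have hne : (hM.eigenvectorBasis i).ofLp ≠ 0 := by
    intro h0
    apply hM.eigenvectorBasis.orthonormal.ne_zero i
    ext j
    simpa using congrFun h0 j
  have hev : A *ᵥ (hM.eigenvectorBasis i).ofLp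
      = (μ - hM.eigenvalues i) • (hM.eigenvectorBasis i).ofLp := by
    rw [sub_mulVec, smul_mulVec, one_mulVec] at h
    rw [sub_smul, ← h]
    abel
  have := hμ _ (Module.End.hasEigenvalue_of_hasEigenvector
    (hasEigenvector_toLin'_iff.2 ⟨hev, hne⟩))
  simp only [Pi.zero_apply]
  linarith

theorem IsHermitian.exists_isGreatest_eigenvalue [Nonempty n] {A : Matrix n n ℝ}
    (hA : A.IsHermitian) :
    ∃ μ, IsGreatest {x : ℝ | Module.End.HasEigenvalue (toLin' A) x} μ := by
  have hfin : {x : ℝ | Module.End.HasEigenvalue (toLin' A) x}.Finite :=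
    Module.End.finite_hasEigenvalue _
  have hne : {x : ℝ | Module.End.HasEigenvalue (toLin' A) x}.Nonempty := by
    obtain ⟨i⟩ := ‹Nonempty n›
    refine ⟨hA.eigenvalues i, Module.End.hasEigenvalue_of_hasEigenvector
      (x := (hA.eigenvectorBasis i).ofLp) (hasEigenvector_toLin'_iff.2
        ⟨hA.mulVec_eigenvectorBasis i, fun h0 => ?_⟩)⟩
    apply hA.eigenvectorBasis.orthonormal.ne_zero i
    ext j
    simpa using congrFun h0 j
  obtain ⟨μ, hμ, h⟩ := hfin.exists_maximalFor id _ hne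
  exact ⟨μ, hμ, fun ν hν => (le_total ν μ).elim id fun hle => h hν hle⟩

/-- The algebraic and the geometric multiplicity of an eigenvalue of a symmetric real matrix
agree. -/
theorem IsHermitian.rootMultiplicity_charpoly {A : Matrix n n ℝ} (hA : A.IsHermitian) (μ : ℝ) :
    A.charpoly.rootMultiplicity μ
      = Module.finrank ℝ (Module.End.eigenspace (toLin' A) μ) := by
  obtain ⟨N, hN⟩ : ∃ N : Module.End ℝ (n → ℝ), N = toLin' A - μ • 1 := ⟨_, rfl⟩
  have hNA : N = toLin' (A - μ • 1) := by
    rw [hN, map_sub, map_smul, toLin'_one]; rfl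
  -- By symmetry `N x ⬝ᵥ N x = x ⬝ᵥ N (N x)`, so generalized eigenvectors are eigenvectors.
  have hsq : ∀ x, N (N x) = 0 → N x = 0 := by
    intro x hx
    rw [hNA, toLin'_apply, toLin'_apply] at hx
    rw [hNA, toLin'_apply]
    have hH : (A - μ • 1).transpose = A - μ • 1 := by
      have : A.transpose = A := by simpa [IsHermitian] using hA
      simp [this]
    rw [← dotProduct_self_eq_zero]
    nth_rewrite 1 [← hH]
    rw [mulVec_transpose, ← dotProduct_mulVec, hx, dotProduct_zero]
  have hpow : ∀ k x, (N ^ (k + 1)) x = 0 → N x = 0 := by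
    intro k
    induction k with
    | zero => intro x hx; simpa using hx
    | succ k ih =>
      intro x hx
      rw [pow_succ, Module.End.mul_apply] at hx
      exact hsq x (ih _ hx)
  have hchar : A.charpoly = (toLin' A).charpoly := by
    rw [← LinearMap.charpoly_toMatrix _ (Pi.basisFun ℝ n), LinearMap.toMatrix_eq_toMatrix',
      LinearMap.toMatrix'_toLin']
  rw [hchar, ← LinearMap.finrank_maxGenEigenspace_eq]
  suffices h : Module.End.maxGenEigenspace (toLin' A) μ = Module.End.eigenspace (toLin' A) μ by
    rw [h]
  ext x
  rw [Module.End.mem_maxGenEigenspace, Module.End.mem_eigenspace_iff, ← hN]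
  have hNx : N x = 0 ↔ toLin' A x = μ • x := by
    rw [hN, LinearMap.sub_apply, sub_eq_zero]; rfl
  rw [← hNx]
  refine ⟨fun ⟨k, hk⟩ => hpow k x ?_, fun h => ⟨1, by simpa using h⟩⟩
  rw [pow_succ', Module.End.mul_apply, hk, map_zero]

end Matrix

/-! ### Perron–Frobenius for adjacency matrices -/

namespace SimpleGraph

open Matrix

variable {W : Type*} [Fintype W] {B : SimpleGraph W} [DecidableRel B.Adj]

/-- A nonnegative eigenvector of a connected graph that vanishes somewhere vanishes everywhere. -/
theorem Preconnected.eq_zero_of_adjMatrix_mulVec (hB : B.Preconnected) {μ : ℝ} {x : W → ℝ}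
    (hx : B.adjMatrix ℝ *ᵥ x = μ • x) (h0 : ∀ i, 0 ≤ x i) {i : W} (hi : x i = 0) : x = 0 := by
  funext j
  obtain ⟨p⟩ := hB i j
  induction p with
  | nil => exact hi
  | @cons u v w huv p ih =>
    refine ih ?_
    -- At a zero of `x`, the nonnegative values at the neighbours sum to zero.
    have h := congrFun hx u
    rw [adjMatrix_mulVec_apply, Pi.smul_apply, hi, smul_zero,
      Finset.sum_eq_zero_iff_of_nonneg fun i _ => h0 i] at h
    exact h v (by simpa using huv)

/-- The entrywise absolute value of an eigenvector to the largest eigenvalue is again one. -/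
theorem adjMatrix_mulVec_abs [DecidableEq W] {μ : ℝ}
    (hμ : ∀ ν, Module.End.HasEigenvalue (toLin' (B.adjMatrix ℝ)) ν → ν ≤ μ) {x : W → ℝ}
    (hx : B.adjMatrix ℝ *ᵥ x = μ • x) : B.adjMatrix ℝ *ᵥ |x| = μ • |x| := by
  have hA : (B.adjMatrix ℝ).IsHermitian := by simp [IsHermitian]
  have hpsd := hA.posSemidef_smul_one_sub hμ
  -- Taking absolute values keeps the diagonal terms and can only increase the sum over adjacent
  -- pairs. Semidefiniteness then makes the form vanish at `|x|`, which puts `|x|` in the kernel.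
  have hle : |x| ⬝ᵥ ((μ • (1 : Matrix W W ℝ) - B.adjMatrix ℝ) *ᵥ |x|)
      ≤ x ⬝ᵥ ((μ • (1 : Matrix W W ℝ) - B.adjMatrix ℝ) *ᵥ x) := by
    simp only [sub_mulVec, smul_mulVec, one_mulVec, dotProduct, Pi.sub_apply, Pi.smul_apply,
      Pi.abs_apply, adjMatrix_mulVec_apply, smul_eq_mul]
    refine Finset.sum_le_sum fun i _ => ?_
    have h1 : |x i| * (μ * |x i|) = x i * (μ * x i) := by
      have := abs_mul_abs_self (x i)
      linear_combination μ * this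
    have h2 : x i * ∑ j ∈ B.neighborFinset i, x j ≤ |x i| * ∑ j ∈ B.neighborFinset i, |x j| := by
      refine (le_abs_self _).trans ?_
      rw [abs_mul]
      gcongr
      exact Finset.abs_sum_le_sum_abs _ _
    rw [mul_sub, mul_sub, h1]
    linarith
  have hzero : (μ • (1 : Matrix W W ℝ) - B.adjMatrix ℝ) *ᵥ x = 0 := by
    rw [sub_mulVec, smul_mulVec, one_mulVec, hx, sub_self]
  rw [hzero, dotProduct_zero] at hle
  have hge := hpsd.dotProduct_mulVec_nonneg |x|
  rw [star_trivial] at hge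
  have h := (hpsd.dotProduct_mulVec_zero_iff |x|).1
    (by rw [star_trivial]; exact le_antisymm hle hge)
  rw [sub_mulVec, smul_mulVec, one_mulVec, sub_eq_zero] at h
  exact h.symm

/-- A finite graph is connected if and only if the largest eigenvalue of its adjacency matrix is
simple and has a positive eigenvector. -/
theorem connected_iff_adjMatrix_eigenvector [DecidableEq W] :
    B.Connected ↔ ∃ μ : ℝ,
      IsGreatest {x : ℝ | Module.End.HasEigenvalue (toLin' (B.adjMatrix ℝ)) x} μ ∧
        (B.adjMatrix ℝ).charpoly.rootMultiplicity μ = 1 ∧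
        ∃ x : W → ℝ, (∀ i, 0 < x i) ∧
          Module.End.HasEigenvector (toLin' (B.adjMatrix ℝ)) μ x := by
  have hA : (B.adjMatrix ℝ).IsHermitian := by simp [IsHermitian]
  constructor
  · intro hB
    have := hB.nonempty
    obtain ⟨μ, hμ⟩ := hA.exists_isGreatest_eigenvalue
    have hvanish : ∀ x : W → ℝ, B.adjMatrix ℝ *ᵥ x = μ • x → ∀ i, x i = 0 → x = 0 := by
      intro x hx i hi
      have h := hB.preconnected.eq_zero_of_adjMatrix_mulVec
        (adjMatrix_mulVec_abs (fun ν hν => hμ.2 hν) hx) (fun i => abs_nonneg (x i))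
        (i := i) (by simp [hi])
      simpa using h
    obtain ⟨x, hx⟩ := hμ.1.exists_hasEigenvector
    obtain ⟨hxe, hx0⟩ := hasEigenvector_toLin'_iff.1 hx
    refine ⟨μ, hμ, ?_, |x|, fun i => abs_pos.2 fun hi => hx0 (hvanish x hxe i hi),
      hasEigenvector_toLin'_iff.2
        ⟨adjMatrix_mulVec_abs (fun ν hν => hμ.2 hν) hxe, by simpa using hx0⟩⟩
    rw [hA.rootMultiplicity_charpoly, finrank_eq_one_iff_of_nonzero' ⟨x, hx.1⟩ (by simpa using hx0)]
    rintro ⟨y, hy⟩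
    obtain ⟨i⟩ := this
    have hxi : x i ≠ 0 := fun hi => hx0 (hvanish x hxe i hi)
    rw [Module.End.mem_eigenspace_iff, toLin'_apply] at hy
    refine ⟨y i / x i, Subtype.ext ?_⟩
    -- The scalar makes this combination vanish at `i`.
    have := hvanish ((y i / x i) • x - y) (by
      rw [mulVec_sub, mulVec_smul, hxe, hy, smul_sub, smul_comm]) i (by simp [hxi])
    simpa [sub_eq_zero] using this
  · rintro ⟨μ, -, hmult, x, hpos, hx⟩
    obtain ⟨hxe, hx0⟩ := hasEigenvector_toLin'_iff.1 hx
    have hne : Nonempty W := by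
      by_contra h
      rw [not_nonempty_iff] at h
      exact hx0 (Subsingleton.elim _ _)
    rw [hA.rootMultiplicity_charpoly,
      finrank_eq_one_iff_of_nonzero' ⟨x, hx.1⟩ (by simpa using hx0)] at hmult
    refine ⟨fun i j => ?_⟩
    by_contra hij
    classical
    -- The restriction of `x` to the component of `i` is again an eigenvector, but not a multiple of
    -- `x`.
    set y : W → ℝ := fun k => if B.Reachable i k then x k else 0 with hy
    have hye : B.adjMatrix ℝ *ᵥ y = μ • y := by
      funext k
      have hk := congrFun hxe k
      simp only [adjMatrix_mulVec_apply, Pi.smul_apply, smul_eq_mul] at hk ⊢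
      by_cases hr : B.Reachable i k
      · rw [hy]
        simp only [hr, if_true]
        rw [← hk]
        refine Finset.sum_congr rfl fun l hl => if_pos (hr.trans ?_)
        exact Adj.reachable (by simpa using hl)
      · rw [hy]
        simp only [hr, if_false, mul_zero]
        refine Finset.sum_eq_zero fun l hl => if_neg fun hl' => hr (hl'.trans ?_)
        exact (Adj.reachable (by simpa using hl)).symm
    obtain ⟨c, hc⟩ := hmult ⟨y, by rw [Module.End.mem_eigenspace_iff, toLin'_apply, hye]⟩
    have hc' : c • x = y := congrArg Subtype.val hc
    have h1 := congrFun hc' i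
    have h2 := congrFun hc' j
    simp only [hy, Pi.smul_apply, smul_eq_mul, Reachable.refl, if_true, hij, if_false] at h1 h2
    rcases mul_eq_zero.1 h2 with h | h
    · rw [h, zero_mul] at h1
      exact (hpos i).ne h1
    · exact (hpos j).ne' h

end SimpleGraph

/-! ### The doubled graph -/

namespace SimpleMixedGraph

variable {V : Type*}

/-- The two copies of a vertex: an alternating walk is at `copy v true` if its next arc has to be
traversed forwards, and at `copy v false` if it has to be traversed backwards. -/
def copy (v : V) : Bool → V ⊕ V
  | true => Sum.inl v
  | false => Sum.inr v

theorem exists_eq_copy (x : V ⊕ V) : ∃ v b, x = copy v b := by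
  rcases x with v | v
  exacts [⟨v, true, rfl⟩, ⟨v, false, rfl⟩]

theorem copy_inj {v w : V} {b c : Bool} : copy v b = copy w c ↔ v = w ∧ b = c := by
  cases b <;> cases c <;> simp [copy]

/-- The graph on the two copies of the vertices whose adjacency matrix is the integrated adjacency
matrix. -/
def double (G : SimpleMixedGraph V) : SimpleGraph (V ⊕ V) where
  Adj
    | .inl u, .inl v => G.graph.Adj u v
    | .inl u, .inr v => G.Arc u v
    | .inr u, .inl v => G.Arc v u
    | .inr u, .inr v => G.graph.Adj u v
  symm := by
    constructor
    rintro (u | u) (v | v) h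
    exacts [SimpleGraph.Adj.symm h, h, h, SimpleGraph.Adj.symm h]
  loopless := by
    constructor
    rintro (u | u) h
    exacts [G.graph.irrefl h, G.graph.irrefl h]

open Classical in
theorem integratedAdjMatrix_eq (G : SimpleMixedGraph V) :
    G.integratedAdjMatrix = G.double.adjMatrix ℝ := by
  ext (u | u) (v | v) <;> rw [SimpleGraph.adjMatrix_apply] <;>
    simp only [integratedAdjMatrix, edgeMatrix, arcMatrix, double,
      Matrix.fromBlocks_apply₁₁, Matrix.fromBlocks_apply₁₂, Matrix.fromBlocks_apply₂₁,
      Matrix.fromBlocks_apply₂₂, Matrix.transpose_apply, Matrix.of_apply] <;> congr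

/-- `HasArc r v true` says that `v` is the tail, `HasArc r v false` that `v` is the head of an arc
of the relation `r`. -/
def HasArc (r : V → V → Prop) (v : V) : Bool → Prop
  | true => ∃ w, r v w
  | false => ∃ w, r w v

variable {G : SimpleMixedGraph V}

theorem double_adj_copy_self {u v : V} {b : Bool} :
    G.double.Adj (copy u b) (copy v b) ↔ G.graph.Adj u v := by
  cases b <;> rfl

theorem double_adj_of_arc {u v : V} (h : G.Arc u v) :
    G.double.Adj (copy u true) (copy v false) := h

theorem double_adj_copy {u v : V} {b c : Bool} (h : G.double.Adj (copy u b) (copy v c)) :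
    (b = c ∧ G.graph.Adj u v) ∨ (b = true ∧ c = false ∧ G.Arc u v) ∨
      (b = false ∧ c = true ∧ G.Arc v u) := by
  cases b <;> cases c <;> simpa [double, copy] using h

theorem reachable_copy {u v : V} (h : G.graph.Reachable u v) (b : Bool) :
    G.double.Reachable (copy u b) (copy v b) := by
  obtain ⟨p⟩ := h
  induction p with
  | nil => rfl
  | cons h p ih => exact (SimpleGraph.Adj.reachable (double_adj_copy_self.2 h)).trans ih

/-- If no vertex of the undirected component of `v` has an arc of the kind `b`, then the component
of `copy v b` in the doubled graph consists of copies of the same kind. -/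
theorem eq_copy_of_reachable {v : V} {b : Bool}
    (hv : ∀ w, G.graph.Reachable v w → ¬ HasArc G.Arc w b) {x : V ⊕ V}
    (hx : G.double.Reachable (copy v b) x) : ∃ w, x = copy w b ∧ G.graph.Reachable v w := by
  obtain ⟨p⟩ := hx
  generalize hy : copy v b = y at p
  induction p generalizing v with
  | nil => exact ⟨v, hy.symm, .rfl⟩
  | @cons y z x h p ih =>
    subst hy
    obtain ⟨w, c, rfl⟩ := exists_eq_copy z
    rcases double_adj_copy h with ⟨rfl, h'⟩ | ⟨rfl, -, h'⟩ | ⟨rfl, -, h'⟩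
    · obtain ⟨w', hx, hw'⟩ := ih (fun w' hw' => hv w' (h'.reachable.trans hw')) rfl
      exact ⟨w', hx, h'.reachable.trans hw'⟩
    · exact (hv v .rfl ⟨_, h'⟩).elim
    · exact (hv v .rfl ⟨_, h'⟩).elim

/-! ### Projecting components and lifting alternating walks -/

namespace Submixed

theorem le_antisymm' {H K : Submixed G} (h₁ : H ≤ K) (h₂ : K ≤ H) : H = K := by
  rcases H with ⟨H, A, _, _, _⟩
  rcases K with ⟨K, B, _, _, _⟩
  obtain rfl : H = K := le_antisymm h₁.1 h₂.1
  obtain rfl : A = B := by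
    funext u v
    exact propext ⟨h₁.2 u v, h₂.2 u v⟩
  rfl

/-- The projection to `G` of the component of `x` in the doubled graph. -/
def ofDouble (G : SimpleMixedGraph V) (x : V ⊕ V) : Submixed G where
  verts := {v | ∃ b, G.double.Reachable x (copy v b)}
  Adj u v := G.graph.Adj u v ∧ ∃ b, G.double.Reachable x (copy u b)
  adj_sub h := h.1
  edge_vert h := h.2
  symm := by
    constructor
    rintro u v ⟨h, b, hb⟩
    exact ⟨h.symm, b, hb.trans (SimpleGraph.Adj.reachable (double_adj_copy_self.2 h))⟩
  -- An arc lifts to a single edge of the doubled graph, so testing its tail suffices.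
  Arc u v := G.Arc u v ∧ G.double.Reachable x (copy u true)
  arc_sub h := h.1
  arc_fst_mem h := ⟨true, h.2⟩
  arc_snd_mem h := ⟨false, h.2.trans (SimpleGraph.Adj.reachable (double_adj_of_arc h.1))⟩

theorem ofDouble_congr {x y : V ⊕ V} (h : G.double.Reachable x y) :
    ofDouble G x = ofDouble G y := by
  have key : ∀ {x y : V ⊕ V}, G.double.Reachable x y → ofDouble G x ≤ ofDouble G y := by
    intro x y h
    exact ⟨⟨fun v ⟨b, hb⟩ => ⟨b, h.symm.trans hb⟩,
      fun u v ⟨huv, b, hb⟩ => ⟨huv, b, h.symm.trans hb⟩⟩,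
      fun u v ⟨huv, hb⟩ => ⟨huv, h.symm.trans hb⟩⟩
  exact le_antisymm' (key h) (key h.symm)

theorem reachable_of_arc_ofDouble {x : V ⊕ V} {v : V} {b : Bool}
    (h : HasArc (ofDouble G x).Arc v b) : G.double.Reachable x (copy v b) := by
  cases b with
  | true => exact h.choose_spec.2
  | false =>
    obtain ⟨w, hw⟩ := h
    exact hw.2.trans (SimpleGraph.Adj.reachable (double_adj_of_arc hw.1))

theorem reachable_of_undirectedPart {H : Submixed G} {u v : H.verts}
    (h : H.undirectedPart.Reachable u v) : G.graph.Reachable u v :=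
  h.map H.toSubgraph.hom

/-- A path of the doubled graph projects to an alternating walk. -/
theorem exists_walk_ofDouble {x : V ⊕ V} {u v : V} {b c : Bool}
    (hx : G.double.Reachable x (copy u b)) (h : G.double.Reachable (copy u b) (copy v c)) :
    ∃ p : (ofDouble G x).Walk u v, ((!b) :: p.arcDirections).IsChain (· ≠ ·) ∧
      c = (b ^^ p.numArcs.bodd) := by
  -- The prefix `!b` forces the first arc, if any, to have direction `b`; each arc switches copies,
  -- so parity determines the final one.
  obtain ⟨q⟩ := h
  generalize hy : copy u b = y at q
  generalize hz : copy v c = z at q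
  induction q generalizing u b with
  | nil =>
    obtain ⟨rfl, rfl⟩ := copy_inj.1 (hz.trans hy.symm)
    exact ⟨.nil ⟨_, hx⟩, by simp [Walk.arcDirections], by simp [Walk.numArcs, Walk.arcDirections]⟩
  | @cons y y' z h q ih =>
    subst hy
    obtain ⟨w, d, rfl⟩ := exists_eq_copy y'
    obtain ⟨p, hp, hc⟩ := ih (hx.trans h.reachable) rfl hz
    rcases double_adj_copy h with ⟨rfl, h'⟩ | ⟨rfl, rfl, h'⟩ | ⟨rfl, rfl, h'⟩
    · exact ⟨.edge ⟨h', _, hx⟩ p, hp, hc⟩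
    · refine ⟨.forward ⟨h', hx⟩ p, ?_, ?_⟩
      · simpa [Walk.arcDirections] using hp
      · simpa [Walk.numArcs, Walk.arcDirections] using hc
    · refine ⟨.backward ⟨h', hx.trans (SimpleGraph.Adj.reachable (double_adj_of_arc h')).symm⟩ p,
        ?_, ?_⟩
      · simpa [Walk.arcDirections] using hp
      · simpa [Walk.numArcs, Walk.arcDirections] using hc

/-- An alternating walk lifts to the doubled graph. -/
theorem Walk.reachable_copy {H : Submixed G} {u v : V} (p : H.Walk u v) {b : Bool}
    (hp : ((!b) :: p.arcDirections).IsChain (· ≠ ·)) :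
    G.double.Reachable (copy u b) (copy v (b ^^ p.numArcs.bodd)) := by
  induction p generalizing b with
  | nil => simp [numArcs, arcDirections]
  | edge h p ih =>
    exact (SimpleGraph.Adj.reachable (double_adj_copy_self.2 (H.adj_sub h))).trans (ih hp)
  | forward h p ih =>
    simp only [arcDirections, List.isChain_cons_cons] at hp
    obtain rfl : b = true := by simpa using hp.1
    have := ih (b := false) hp.2
    refine (SimpleGraph.Adj.reachable (double_adj_of_arc (H.arc_sub h))).trans ?_
    simpa [numArcs, arcDirections] using this
  | backward h p ih =>
    simp only [arcDirections, List.isChain_cons_cons] at hp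
    obtain rfl : b = false := by simpa using hp.1
    have := ih (b := true) hp.2
    refine (SimpleGraph.Adj.reachable (double_adj_of_arc (H.arc_sub h))).symm.trans ?_
    simpa [numArcs, arcDirections] using this

/-- Supplies the copy from which the walk lifts: the direction of its first arc, or an arbitrary one
if there is no arc. -/
theorem Walk.IsAlternating.exists_isChain {H : Submixed G} {u v : V} {p : H.Walk u v}
    (hp : p.IsAlternating) : ∃ b, ((!b) :: p.arcDirections).IsChain (· ≠ ·) := by
  unfold Walk.IsAlternating at hp
  generalize p.arcDirections = l at hp
  cases l with
  | nil => exact ⟨true, by simp⟩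
  | cons a l => exact ⟨a, by simpa using hp⟩

/-- The undirected component of `v` in `H` contains the tail (if `b` is true) or the head (if `b`
is false) of an arc of `H`. -/
def Active (H : Submixed G) (v : H.verts) (b : Bool) : Prop :=
  ∃ w : H.verts, H.undirectedPart.Reachable v w ∧ HasArc H.Arc w b

theorem Active.congr {H : Submixed G} {u v : H.verts} {b : Bool} (hu : H.Active u b)
    (h : H.undirectedPart.Reachable u v) : H.Active v b :=
  hu.imp fun _ hw => ⟨h.symm.trans hw.1, hw.2⟩

theorem active_of_hasArc {H : Submixed G} {v : H.verts} {b : Bool} (h : HasArc H.Arc v b) :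
    H.Active v b :=
  ⟨v, .rfl, h⟩

/-- A walk without arcs stays in an undirected component; otherwise its two ends are active. -/
theorem Walk.reachable_or_active {H : Submixed G} {u v : V} (p : H.Walk u v) {b : Bool}
    (hp : ((!b) :: p.arcDirections).IsChain (· ≠ ·)) (hu : u ∈ H.verts) (hv : v ∈ H.verts) :
    (p.numArcs = 0 ∧ H.undirectedPart.Reachable ⟨u, hu⟩ ⟨v, hv⟩) ∨
      H.Active ⟨u, hu⟩ b ∧ H.Active ⟨v, hv⟩ (b ^^ p.numArcs.bodd) := by
  induction p generalizing b with
  | nil => exact .inl ⟨rfl, .rfl⟩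
  | @edge u w v h p ih =>
    have huw : H.undirectedPart.Adj ⟨u, hu⟩ ⟨w, H.edge_vert h.symm⟩ := h
    rcases ih hp (H.edge_vert h.symm) hv with ⟨h₀, h'⟩ | ⟨h₁, h₂⟩
    · exact .inl ⟨h₀, huw.reachable.trans h'⟩
    · exact .inr ⟨h₁.congr huw.reachable.symm, h₂⟩
  | @forward u w v h p ih =>
    simp only [arcDirections, List.isChain_cons_cons] at hp
    obtain rfl : b = true := by simpa using hp.1
    have hw : H.Active ⟨w, H.arc_snd_mem h⟩ false := active_of_hasArc ⟨u, h⟩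
    have hn : (forward h p).numArcs = p.numArcs + 1 := rfl
    refine .inr ⟨active_of_hasArc ⟨w, h⟩, ?_⟩
    -- If no arc remains, the end lies in the undirected component of the head `w`.
    rcases ih (b := false) hp.2 (H.arc_snd_mem h) hv with ⟨h₀, h'⟩ | ⟨-, h₂⟩
    · simpa [hn, h₀] using hw.congr h'
    · simpa [hn] using h₂
  | @backward u w v h p ih =>
    simp only [arcDirections, List.isChain_cons_cons] at hp
    obtain rfl : b = false := by simpa using hp.1
    have hw : H.Active ⟨w, H.arc_fst_mem h⟩ true := active_of_hasArc ⟨u, h⟩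
    have hn : (backward h p).numArcs = p.numArcs + 1 := rfl
    refine .inr ⟨active_of_hasArc ⟨w, h⟩, ?_⟩
    rcases ih (b := true) hp.2 (H.arc_fst_mem h) hv with ⟨h₀, h'⟩ | ⟨-, h₂⟩
    · simpa [hn, h₀] using hw.congr h'
    · simpa [hn] using h₂

/-! ### Special submixed graphs and components of the doubled graph -/

namespace IsSpecial

variable {H : Submixed G}

/-- This is the role of condition 2: a closed alternating walk with an odd number of arcs lifts to a
path between the two copies of `v`. -/
theorem reachable_of_active_self (hH : H.IsSpecial) {v : H.verts} {b c : Bool}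
    (hb : H.Active v b) (hc : H.Active v c) :
    G.double.Reachable (copy (v : V) b) (copy (v : V) c) := by
  have key : H.Active v true → H.Active v false →
      G.double.Reachable (copy (v : V) true) (copy (v : V) false) := by
    rintro ⟨y, hy, hy'⟩ ⟨x, hx, hx'⟩
    obtain ⟨p, hp, hodd⟩ := hH.odd_closed (H.undirectedPart.connectedComponentMk v)
      ⟨x, SimpleGraph.ConnectedComponent.sound hx.symm, hx'⟩
      ⟨y, SimpleGraph.ConnectedComponent.sound hy.symm, hy'⟩ v rfl
    obtain ⟨d, hd⟩ := hp.exists_isChain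
    have h := p.reachable_copy hd
    rw [show p.numArcs.bodd = true by
      rw [Nat.odd_iff, Nat.mod_two_of_bodd] at hodd
      cases hb : p.numArcs.bodd <;> simp_all] at h
    cases d with
    | true => exact h
    | false => exact h.symm
  cases b <;> cases c
  exacts [.rfl, (key hc hb).symm, key hb hc, .rfl]

/-- The active copies of the vertices of a special submixed graph lie in one component of the
doubled graph. -/
theorem reachable_of_active (hH : H.IsSpecial) {u v : H.verts} {b c : Bool}
    (hb : H.Active u b) (hc : H.Active v c) :
    G.double.Reachable (copy (u : V) b) (copy (v : V) c) := by
  rcases eq_or_ne u v with rfl | huv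
  · exact hH.reachable_of_active_self hb hc
  obtain ⟨p, hp⟩ := hH.joined u u.2 v v.2 (Subtype.coe_injective.ne huv)
  obtain ⟨d, hd⟩ := hp.exists_isChain
  rcases p.reachable_or_active hd u.2 v.2 with ⟨-, h⟩ | ⟨h₁, h₂⟩
  · exact (hH.reachable_of_active_self hb (hc.congr h.symm)).trans
      (SimpleMixedGraph.reachable_copy (reachable_of_undirectedPart h) c)
  · exact (hH.reachable_of_active_self hb h₁).trans
      ((p.reachable_copy hd).trans (hH.reachable_of_active_self h₂ hc))

/-- An alternating walk to the tail of an arc either uses no arc, and then stays in the component of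
that tail, or makes its own starting point active. -/
theorem exists_active (hH : H.IsSpecial) (v : H.verts) : ∃ b, H.Active v b := by
  obtain ⟨a, w, h⟩ := hH.exists_arc
  have ha : H.Active ⟨a, H.arc_fst_mem h⟩ true := active_of_hasArc ⟨w, h⟩
  rcases eq_or_ne v ⟨a, H.arc_fst_mem h⟩ with rfl | hva
  · exact ⟨_, ha⟩
  obtain ⟨p, hp⟩ := hH.joined v v.2 a (H.arc_fst_mem h) fun h' => hva (Subtype.ext h')
  obtain ⟨d, hd⟩ := hp.exists_isChain
  rcases p.reachable_or_active hd v.2 (H.arc_fst_mem h) with ⟨-, h⟩ | ⟨h₁, -⟩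
  · exact ⟨_, ha.congr h.symm⟩
  · exact ⟨_, h₁⟩

/-- Every vertex has an active copy, and all active copies lie in the component of `copy u true`. -/
theorem le_ofDouble (hH : H.IsSpecial) {x : V ⊕ V} {u v : V} (h : H.Arc u v)
    (hx : G.double.Reachable x (copy u true)) : H ≤ ofDouble G x := by
  have hu : H.Active ⟨u, H.arc_fst_mem h⟩ true := active_of_hasArc ⟨v, h⟩
  have hverts : ∀ w ∈ H.verts, ∃ b, G.double.Reachable x (copy w b) := by
    intro w hw
    obtain ⟨b, hb⟩ := hH.exists_active ⟨w, hw⟩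
    exact ⟨b, hx.trans (hH.reachable_of_active hu hb)⟩
  refine ⟨⟨hverts, fun w z hwz => ⟨H.adj_sub hwz, hverts w (H.edge_vert hwz)⟩⟩,
    fun w z hwz => ⟨H.arc_sub hwz, hx.trans ?_⟩⟩
  exact hH.reachable_of_active (v := ⟨w, H.arc_fst_mem hwz⟩) hu (active_of_hasArc ⟨z, hwz⟩)

end IsSpecial

/-- Paths project to alternating walks. If an undirected component contains a head and a tail, both
copies of each of its vertices are reached, and a path between them projects to a closed walk with
an odd number of arcs. -/
theorem isSpecial_ofDouble {x : V ⊕ V} {u v : V} (h : G.Arc u v)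
    (hx : G.double.Reachable x (copy u true)) : (ofDouble G x).IsSpecial where
  exists_arc := ⟨u, v, h, hx⟩
  joined := by
    rintro w ⟨b, hb⟩ z ⟨c, hc⟩ -
    obtain ⟨p, hp, -⟩ := exists_walk_ofDouble hb (hb.symm.trans hc)
    exact ⟨p, hp.tail⟩
  odd_closed := by
    rintro C ⟨y, hy, hy'⟩ ⟨z, hz, hz'⟩ w hw
    have hyw := reachable_of_undirectedPart
      (SimpleGraph.ConnectedComponent.exact (hy.trans hw.symm))
    have hzw := reachable_of_undirectedPart
      (SimpleGraph.ConnectedComponent.exact (hz.trans hw.symm))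
    have h₁ := (reachable_of_arc_ofDouble (b := false) hy').trans
      (SimpleMixedGraph.reachable_copy hyw false)
    have h₂ := (reachable_of_arc_ofDouble (b := true) hz').trans
      (SimpleMixedGraph.reachable_copy hzw true)
    obtain ⟨p, hp, hodd⟩ := exists_walk_ofDouble h₂ (h₂.symm.trans h₁)
    refine ⟨p, hp.tail, ?_⟩
    rw [Nat.odd_iff, Nat.mod_two_of_bodd, show p.numArcs.bodd = true by simpa using hodd]
    rfl

/-- A larger special submixed graph still contains the arc from `u` to `v`, so `le_ofDouble` bounds
it by the same projection. -/
theorem maximal_isSpecial_ofDouble {x : V ⊕ V} {u v : V} (h : G.Arc u v)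
    (hx : G.double.Reachable x (copy u true)) : Maximal IsSpecial (ofDouble G x) :=
  ⟨isSpecial_ofDouble h hx, fun _ hK hle => hK.le_ofDouble (hle.2 u v ⟨h, hx⟩) hx⟩

theorem eq_ofDouble_of_maximal {H : Submixed G} (hH : Maximal IsSpecial H) {u v : V}
    (h : H.Arc u v) : H = ofDouble G (copy u true) := by
  have hle := hH.1.le_ofDouble h .rfl
  exact le_antisymm' hle (hH.2 (isSpecial_ofDouble (H.arc_sub h) .rfl) hle)

/-- The component of `copy v b` projects to the undirected component of `v` if that has no arcs of
kind `b`. -/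
theorem toSubgraph_ofDouble_copy {v : V} {b : Bool}
    (hv : ∀ w, G.graph.Reachable v w → ¬ HasArc G.Arc w b) :
    (ofDouble G (copy v b)).toSubgraph = (G.graph.connectedComponentMk v).toSubgraph := by
  have hmem : ∀ w, (∃ c, G.double.Reachable (copy v b) (copy w c)) ↔ G.graph.Reachable v w := by
    refine fun w => ⟨fun ⟨c, hc⟩ => ?_, fun h => ⟨b, SimpleMixedGraph.reachable_copy h b⟩⟩
    obtain ⟨w', hw, hw'⟩ := eq_copy_of_reachable hv hc
    exact (copy_inj.1 hw).1 ▸ hw'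
  have hsupp : ∀ w, w ∈ (G.graph.connectedComponentMk v).supp ↔ G.graph.Reachable v w := fun w => by
    rw [SimpleGraph.ConnectedComponent.mem_supp_iff, SimpleGraph.ConnectedComponent.eq,
      SimpleGraph.reachable_comm]
  ext w z
  · exact (hmem w).trans (hsupp w).symm
  · simp only [SimpleGraph.Subgraph.induce_adj, SimpleGraph.Subgraph.top_adj, hsupp]
    refine ⟨fun h => ?_, fun ⟨h₁, _, h⟩ => ⟨h, (hmem w).2 h₁⟩⟩
    have := (hmem w).1 h.2
    exact ⟨this, this.trans h.1.reachable, h.1⟩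

/-- The ends of an arc would be reached in copies of different kinds. -/
theorem not_arc_ofDouble_copy {v : V} {b : Bool}
    (hv : ∀ w, G.graph.Reachable v w → ¬ HasArc G.Arc w b) (u w : V) :
    ¬ (ofDouble G (copy v b)).Arc u w := by
  intro h
  obtain ⟨u', hu, hu'⟩ := eq_copy_of_reachable hv (reachable_of_arc_ofDouble (b := true) ⟨w, h⟩)
  obtain ⟨w', hw, hw'⟩ := eq_copy_of_reachable hv (reachable_of_arc_ofDouble (b := false) ⟨u, h⟩)
  exact absurd ((copy_inj.1 hu).2.trans (copy_inj.1 hw).2.symm) (by simp)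

end Submixed

/-! ### Mixed components as components of the doubled graph -/

open Submixed

/-- The type of the mixed components consisting of a single copy of an undirected component. -/
def undirectedType : Bool → ComponentType
  | true => .I
  | false => .II

theorem isMixedComponent_undirectedType {b : Bool} {H : Submixed G} :
    G.IsMixedComponent (undirectedType b) H ↔
      H.IsUndirectedComponent ∧ ∀ u ∈ H.verts, ¬ HasArc G.Arc u b := by
  cases b <;> simp [undirectedType, IsMixedComponent, HasArc]

open Classical in
/-- The mixed component to which a component of the doubled graph corresponds. -/
noncomputable def componentOf (G : SimpleMixedGraph V) (v : V) (b : Bool) :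
    ComponentType × Submixed G :=
  (if ∃ u w, (ofDouble G (copy v b)).Arc u w then .III else undirectedType b,
    ofDouble G (copy v b))

theorem not_hasArc_of_forall_not_arc {v : V} {b : Bool}
    (h : ¬ ∃ u w, (ofDouble G (copy v b)).Arc u w) (w : V) (hw : G.graph.Reachable v w) :
    ¬ HasArc G.Arc w b := by
  have hr := SimpleMixedGraph.reachable_copy hw b
  intro hb
  cases b with
  | true => exact h ⟨w, hb.choose, hb.choose_spec, hr⟩
  | false =>
    obtain ⟨z, hz⟩ := hb
    exact h ⟨z, w, hz, hr.trans (SimpleGraph.Adj.reachable (double_adj_of_arc hz)).symm⟩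

theorem componentOf_of_not_hasArc {v : V} {b : Bool}
    (hv : ∀ w, G.graph.Reachable v w → ¬ HasArc G.Arc w b) :
    G.componentOf v b = (undirectedType b, ofDouble G (copy v b)) := by
  rw [componentOf, if_neg]
  rintro ⟨u, w, h⟩
  exact not_arc_ofDouble_copy hv u w h

theorem componentOf_mem (v : V) (b : Bool) : G.componentOf v b ∈ G.mixedComponents := by
  by_cases h : ∃ u w, (ofDouble G (copy v b)).Arc u w
  · rw [componentOf, if_pos h]
    obtain ⟨u, w, h⟩ := h
    exact maximal_isSpecial_ofDouble h.1 h.2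
  · have hv := not_hasArc_of_forall_not_arc h
    rw [componentOf_of_not_hasArc hv]
    refine isMixedComponent_undirectedType.2 ⟨⟨⟨_, toSubgraph_ofDouble_copy hv⟩,
      not_arc_ofDouble_copy hv⟩, fun u ⟨c, hu⟩ => ?_⟩
    obtain ⟨w, huw, hw⟩ := eq_copy_of_reachable hv hu
    exact hv u ((copy_inj.1 huw).1 ▸ hw)

theorem exists_componentOf_undirectedType {H : Submixed G} {b : Bool}
    (h : G.IsMixedComponent (undirectedType b) H) :
    ∃ v, (undirectedType b, H) = G.componentOf v b := by
  obtain ⟨⟨⟨C, hC⟩, harc⟩, hH⟩ := isMixedComponent_undirectedType.1 h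
  induction C using SimpleGraph.ConnectedComponent.ind with | _ v
  have hv : ∀ w, G.graph.Reachable v w → ¬ HasArc G.Arc w b := by
    intro w hw
    refine hH w ?_
    rw [hC]
    exact SimpleGraph.ConnectedComponent.sound hw.symm
  have hG := toSubgraph_ofDouble_copy hv
  refine ⟨v, ?_⟩
  rw [componentOf_of_not_hasArc hv]
  congr 1
  refine le_antisymm' ⟨(hC.trans hG.symm).le, fun u w h => (harc u w h).elim⟩
    ⟨(hG.trans hC.symm).le, fun u w h => (not_arc_ofDouble_copy hv u w h).elim⟩

theorem exists_componentOf {c : ComponentType × Submixed G} (hc : c ∈ G.mixedComponents) :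
    ∃ v b, c = G.componentOf v b := by
  obtain ⟨t, H⟩ := c
  cases t with
  | I => exact (exists_componentOf_undirectedType (b := true) hc).imp fun _ h => ⟨true, h⟩
  | II => exact (exists_componentOf_undirectedType (b := false) hc).imp fun _ h => ⟨false, h⟩
  | III =>
    have hmax : Maximal IsSpecial H := hc
    obtain ⟨u, v, h⟩ := hmax.1.exists_arc
    have hH := eq_ofDouble_of_maximal hmax h
    exact ⟨u, true, by rw [componentOf, if_pos ⟨u, v, hH ▸ h⟩, ← hH]⟩

/-- Two components whose projections share an arc share its lift. Without arcs the projection does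
not show which copy it came from, but the type does; hence the double counting of Types I and II. -/
theorem componentOf_eq_iff {v w : V} {b c : Bool} :
    G.componentOf v b = G.componentOf w c ↔ G.double.Reachable (copy v b) (copy w c) := by
  constructor
  · intro h
    have hH : ofDouble G (copy v b) = ofDouble G (copy w c) := congrArg Prod.snd h
    by_cases harc : ∃ u z, (ofDouble G (copy v b)).Arc u z
    · obtain ⟨u, z, h₁⟩ := harc
      have h₂ := h₁
      rw [hH] at h₂
      exact h₁.2.trans h₂.2.symm
    · have hv := not_hasArc_of_forall_not_arc harc
      rw [hH] at harc
      have hw := not_hasArc_of_forall_not_arc harc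
      rw [componentOf_of_not_hasArc hv, componentOf_of_not_hasArc hw] at h
      obtain rfl : b = c := by
        have := congrArg Prod.fst h
        cases b <;> cases c <;> simp_all [undirectedType]
      have hmem : w ∈ (ofDouble G (copy v b)).verts := hH ▸ ⟨b, .rfl⟩
      obtain ⟨d, hd⟩ := hmem
      obtain ⟨w', hw', -⟩ := eq_copy_of_reachable hv hd
      exact (copy_inj.1 hw').2 ▸ hd
  · intro h
    by_cases harc : ∃ u z, (ofDouble G (copy v b)).Arc u z
    · rw [componentOf, componentOf, ← ofDouble_congr h, if_pos harc, if_pos harc]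
    · obtain ⟨w', hw', -⟩ := eq_copy_of_reachable (not_hasArc_of_forall_not_arc harc) h
      obtain rfl := (copy_inj.1 hw').2
      rw [componentOf, componentOf, ofDouble_congr h]

theorem uniconnected_iff_connected_double : G.Uniconnected ↔ G.double.Connected := by
  rw [Uniconnected, Set.encard_eq_one]
  constructor
  · rintro ⟨c, hc⟩
    have hall : ∀ v b, G.componentOf v b = c := fun v b => by
      simpa [hc] using G.componentOf_mem v b
    obtain ⟨v, b, -⟩ := exists_componentOf (c := c) (hc ▸ rfl)
    have : Nonempty (V ⊕ V) := ⟨copy v b⟩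
    refine ⟨fun x y => ?_⟩
    obtain ⟨u, b, rfl⟩ := exists_eq_copy x
    obtain ⟨w, c, rfl⟩ := exists_eq_copy y
    exact componentOf_eq_iff.1 ((hall u b).trans (hall w c).symm)
  · intro h
    obtain ⟨x⟩ := h.nonempty
    obtain ⟨v, b, rfl⟩ := exists_eq_copy x
    refine ⟨G.componentOf v b, Set.eq_singleton_iff_unique_mem.2 ⟨componentOf_mem v b, ?_⟩⟩
    intro c hc
    obtain ⟨w, d, rfl⟩ := exists_componentOf hc
    exact componentOf_eq_iff.2 (h.preconnected _ _)

end SimpleMixedGraph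

theorem mainTheorem3 {V : Type*} [Fintype V] [DecidableEq V] (G : SimpleMixedGraph V) :
    G.Uniconnected ↔
      ∃ μ : ℝ, G.IsLargestEigenvalue μ ∧
        G.integratedAdjMatrix.charpoly.rootMultiplicity μ = 1 ∧
        ∃ x : V ⊕ V → ℝ, (∀ i, 0 < x i) ∧
          Module.End.HasEigenvector (Matrix.toLin' G.integratedAdjMatrix) μ x := by
  classical
  rw [SimpleMixedGraph.uniconnected_iff_connected_double,
    SimpleGraph.connected_iff_adjMatrix_eigenvector]
  simp only [SimpleMixedGraph.IsLargestEigenvalue, SimpleMixedGraph.integratedAdjMatrix_eq]
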